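/- Let $F_Q$ be the set of pairs $(p,m)$ of natural numbers with $p$ prime and $\gcd(p,m)=1$ such that $p\nmid|\mathrm{Aut}(Q)|$ for every group $Q$ of order $m$, and let $F_S$ be the set of pairs $(p,m)$ with $p$ prime and $\gcd(p,m)=1$ such that every group of order $mp$ has exactly one Sylow $p$-subgroup. For a finite group $\Gamma$ let $B=\mathrm{Perm}(\Gamma)$, and let $\lambda:\Gamma\to B$ be the left regular representation. A subgroup $N\le B$ is called regular if it acts transitively on $\Gamma$ and only its identity element has a fixed point. For a group $M$ with $|M|=|\Gamma|$, let $R(\Gamma,[M])$ be the set of regular subgroups $N\le B$ such that $N\cong M$ and $\lambda(\Gamma)\le \mathrm{Norm}_B(N)$, and let $R(\Gamma)$ be the union of the sets $R(\Gamma,[M])$ over all groups $M$ of order $|\Gamma|$. Let $(p,m)\in F_Q\cap F_S$, let $\Gamma$ be a group of order $mp$, and let $\mathcal P$ be the (unique) Sylow $p$-subgroup of $\lambda(\Gamma)$. Then every $N\in R(\Gamma)$ is contained in $\mathrm{Norm}_B(\mathcal P)$. Moreover, $(p,m)\in F_Q\cap F_S$ for every prime $p$ and every integer $m$ with $1\le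 m<p$, so this extends the case $p>m$. -/

import Mathlib

namespace HopfGaloisRegular

/-- The image `λ(Γ)` of the left regular representation of `Γ` in `B = Perm(Γ)`. -/
def leftRegular (Γ : Type*) [Group Γ] : Subgroup (Equiv.Perm Γ) :=
  (MulAction.toPermHom Γ Γ).range

/-- A regular subgroup of `Perm(X)`: it acts transitively on `X`, and only the identity has a
fixed point. -/
def IsRegular {X : Type*} (N : Subgroup (Equiv.Perm X)) : Prop :=
  (∀ x y : X, ∃ η ∈ N, η x = y) ∧ ∀ η ∈ N, ∀ x : X, η x = x → η = 1

/-- `R(Γ, [M])`: the regular subgroups `N` of `Perm(Γ)` that are isomorphic to `M` and normalized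
by `λ(Γ)`. -/
def regularSubgroupsOfType (Γ M : Type*) [Group Γ] [Group M] :
    Set (Subgroup (Equiv.Perm Γ)) :=
  {N | IsRegular N ∧ Nonempty (N ≃* M) ∧ leftRegular Γ ≤ Subgroup.normalizer N}

/-- `R(Γ)`: the union of the sets `R(Γ, [M])` over all groups `M` of the same order as `Γ`. -/
def regularSubgroups.{u} (Γ : Type u) [Group Γ] : Set (Subgroup (Equiv.Perm Γ)) :=
  {N | ∃ (M : Type u) (_ : Group M), Nat.card M = Nat.card Γ ∧ N ∈ regularSubgroupsOfType Γ M}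

/-- The pairs `(p, m)` with `p` prime and coprime to `m` such that `p` does not divide `|Aut(Q)|`
for any group `Q` of order `m`. Such `m` is positive, so that these are finite groups, and up to
isomorphism they all live in `Type`. -/
def FQ : Set (ℕ × ℕ) :=
  {pm | pm.1.Prime ∧ Nat.gcd pm.1 pm.2 = 1 ∧
    ∀ (Q : Type) [Group Q], Nat.card Q = pm.2 → ¬ pm.1 ∣ Nat.card (MulAut Q)}

/-- The pairs `(p, m)` with `p` prime and coprime to `m` such that every group of order `mp` has
exactly one Sylow `p`-subgroup. -/
def FS : Set (ℕ × ℕ) :=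
  {pm | pm.1.Prime ∧ Nat.gcd pm.1 pm.2 = 1 ∧
    ∀ (G : Type) [Group G], Nat.card G = pm.2 * pm.1 → Nat.card (Sylow pm.1 G) = 1}

end HopfGaloisRegular

namespace HopfGaloisRegular

open Subgroup

/-! Let `π` generate the Sylow `p`-subgroup of `λ(Γ)` and `ν` that of `N`; both have order `p`.
Conjugation by `π` acts trivially on `N ⧸ ⟨ν⟩` because `p` does not divide the order of its
automorphism group, and `π` commutes with `ν`. Since `m` is prime to `p`, `π` preserves each
`⟨ν⟩`-orbit, so `π x = ν ^ α(x) x` with `α(x)` a nonzero residue mod `p`. Elements of `N` transform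
`α` by affine maps `t ↦ b + c t`, elements of `λ(Γ)` by scalings. If `α` is constant, `π` is a power
of `ν`, and `N` normalizes `⟨π⟩`. Otherwise transitivity of `λ(Γ)` gives a scaling other than `1`
that preserves the image `S` of `α`, so `S` has sum `0`. Invariance of this sum under the affine
maps gives `|S| b = 0`; as `0 < |S| < p`, `b = 0`, and `N` centralizes `π`. -/

theorem exists_type_mulEquiv (G : Type*) [Group G] [Finite G] :
    ∃ (Q : Type) (_ : Group Q), Nonempty (G ≃* Q) := by
  obtain ⟨n, ⟨e⟩⟩ := Finite.exists_equiv_fin G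
  exact ⟨Fin n, e.symm.group, ⟨@MulEquiv.symm _ _ (_) _ (@Equiv.mulEquiv _ _ e.symm _)⟩⟩

/-- `FQ` quantifies over groups in `Type` only; a finite group in any universe has a copy there. -/
theorem not_dvd_card_mulAut_of_mem_FQ {p m : ℕ} (h : (p, m) ∈ FQ) (Q : Type*) [Group Q]
    [Finite Q] (hQ : Nat.card Q = m) : ¬ p ∣ Nat.card (MulAut Q) := by
  obtain ⟨R, _, ⟨e⟩⟩ := exists_type_mulEquiv Q
  rw [Nat.card_congr (MulAut.congr e).toEquiv]
  exact h.2.2 R ((Nat.card_congr e.toEquiv).symm.trans hQ)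

theorem subsingleton_sylow_of_mem_FS {p m : ℕ} (h : (p, m) ∈ FS) (G : Type*) [Group G]
    [Finite G] (hG : Nat.card G = m * p) : Subsingleton (Sylow p G) := by
  have : Fact p.Prime := ⟨h.1⟩
  obtain ⟨R, _, ⟨e⟩⟩ := exists_type_mulEquiv G
  have h1 := h.2.2 R ((Nat.card_congr e.toEquiv).symm.trans hG)
  have : Subsingleton (Sylow p R) := (Nat.card_eq_one_iff_unique.1 h1).1
  have he : Function.Surjective e.toMonoidHom := e.surjective
  refine ⟨fun P P' => Sylow.ext (Subgroup.map_injective (f := e.toMonoidHom) e.injective ?_)⟩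
  rw [← Sylow.coe_mapSurjective he, ← Sylow.coe_mapSurjective he,
    Subsingleton.elim (P.mapSurjective he) (P'.mapSurjective he)]

theorem card_sylow_eq_prime {p m : ℕ} (hp : p.Prime) (hpm : Nat.gcd p m = 1) {G : Type*} [Group G]
    [Finite G] (hG : Nat.card G = m * p) (P : Sylow p G) : Nat.card P = p := by
  have : Fact p.Prime := ⟨hp⟩
  have hm : ¬ p ∣ m := (hp.coprime_iff_not_dvd).1 hpm
  have hm0 : m ≠ 0 := by rintro rfl; exact hm (dvd_zero p)
  have := P.card_eq_multiplicity
  rwa [hG, Nat.factorization_mul hm0 hp.ne_zero, Finsupp.add_apply, hp.factorization_self,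
    Nat.factorization_eq_zero_of_not_dvd hm, zero_add, pow_one] at this

/-- A generator of the image in the ambient group of a unique Sylow subgroup of prime order. -/
theorem exists_generator_of_subsingleton_sylow {p : ℕ} (hp : p.Prime) {B : Type*} [Group B]
    [Finite B] {H : Subgroup B} [Subsingleton (Sylow p H)] (P : Sylow p H)
    (hP : Nat.card P = p) :
    ∃ π ∈ H, (P : Subgroup H).map H.subtype = zpowers π ∧ orderOf π = p ∧
      ∀ h ∈ normalizer (H : Set B), ∃ u : ℕ, h * π = π ^ u * h := by
  have : Fact p.Prime := ⟨hp⟩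
  have : IsCyclic P := isCyclic_of_prime_card hP
  obtain ⟨g, hg⟩ := IsCyclic.exists_generator (α := P)
  have hmap : (P : Subgroup H).map H.subtype = zpowers ((g : H) : B) := by
    ext x
    constructor
    · rintro ⟨y, hy, rfl⟩
      obtain ⟨k, hk⟩ := mem_zpowers_iff.1 (hg ⟨y, hy⟩)
      refine mem_zpowers_iff.2 ⟨k, ?_⟩
      have := congrArg (fun z : P => ((z : H) : B)) hk
      simpa using this
    · intro hx
      obtain ⟨k, rfl⟩ := mem_zpowers_iff.1 hx
      exact zpow_mem (mem_map_of_mem H.subtype g.2) k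
  refine ⟨((g : H) : B), (g : H).2, hmap, ?_, ?_⟩
  · rw [← Nat.card_zpowers, ← hmap, Nat.card_congr
      ((P : Subgroup H).equivMapOfInjective _ H.subtype_injective).symm.toEquiv]
    exact hP
  · intro h hh
    let φ : MulAut H := H.normalizerMonoidHom ⟨h, hh⟩
    have hφ : ((φ g : H) : B) = h * ((g : H) : B) * h⁻¹ := rfl
    have hmem : φ g ∈ (P : Subgroup H) := by
      have := characteristic_iff_le_comap.1 (Sylow.characteristic_of_subsingleton P) φ
      exact this g.2
    have h2 : h * ((g : H) : B) * h⁻¹ ∈ zpowers ((g : H) : B) := by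
      rw [← hmap, ← hφ]
      exact mem_map_of_mem H.subtype hmem
    obtain ⟨u, hu⟩ := mem_powers_iff_mem_zpowers.2 h2
    exact ⟨u, by simp only at hu; rw [hu]; group⟩

/-! ### Automorphisms of order dividing `p` -/

theorem apply_mul_inv_mem_of_not_dvd_card_mulAut {p : ℕ} (hp : p.Prime) {G : Type*} [Group G]
    (K : Subgroup G) [hK : K.Characteristic] (hA : ¬ p ∣ Nat.card (MulAut (G ⧸ K)))
    (φ : MulAut G) (hφ : φ ^ p = 1) (g : G) : φ g * g⁻¹ ∈ K := by
  let ψ : MulAut (G ⧸ K) := QuotientGroup.congr K K φ (characteristic_iff_map_eq.1 hK φ)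
  have hψ : ∀ (k : ℕ) (g : G), (ψ ^ k) (g : G ⧸ K) = (((φ ^ k) g : G) : G ⧸ K) := by
    intro k
    induction k with
    | zero => intro g; rfl
    | succ k ih =>
      intro g
      rw [pow_succ, pow_succ, MulAut.mul_apply, MulAut.mul_apply, ← ih]
      rfl
  have hψp : ψ ^ p = 1 := by
    ext x
    obtain ⟨g, rfl⟩ := QuotientGroup.mk_surjective x
    rw [hψ, hφ]
    rfl
  have hψ1 : ψ = 1 := by
    by_contra hne
    have : Fact p.Prime := ⟨hp⟩
    exact hA (orderOf_eq_prime hψp hne ▸ orderOf_dvd_natCard ψ)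
  have h1 : ((φ g : G) : G ⧸ K) = (g : G ⧸ K) := by
    have := hψ 1 g
    rw [hψ1, one_pow, pow_one] at this
    exact this.symm
  rw [← div_eq_mul_inv]
  exact (QuotientGroup.eq_one_iff _).1 (by rw [QuotientGroup.mk_div, h1, div_self'])

/-- An element of order `p` cannot act nontrivially by conjugation on a group of order `p`. -/
theorem commute_of_mul_eq_pow_mul {p : ℕ} (hp : p.Prime) {B : Type*} [Group B] {π ν : B}
    (hπ : π ^ p = 1) (hν : orderOf ν = p) {c : ℕ} (h : π * ν = ν ^ c * π) : Commute π ν := by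
  have : Fact p.Prime := ⟨hp⟩
  have hk : ∀ k : ℕ, π ^ k * ν = ν ^ c ^ k * π ^ k := by
    intro k
    induction k with
    | zero => simp
    | succ k ih =>
      have hs : SemiconjBy π ν (ν ^ c) := h
      have := (hs.pow_right (c ^ k)).eq
      rw [pow_succ', mul_assoc, ih, ← mul_assoc, this, ← pow_mul, pow_succ' c, mul_assoc]
  -- Taking `k = p` gives `c ^ p = 1` mod `p`, while Fermat gives `c ^ p = c`.
  have h1 := hk p
  rw [hπ, one_mul, mul_one] at h1
  have h2 : ν ^ 1 = ν ^ c ^ p := by rw [pow_one]; exact h1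
  rw [pow_eq_pow_iff_modEq, hν, ← ZMod.natCast_eq_natCast_iff, Nat.cast_pow, ZMod.pow_card] at h2
  have h3 : ν ^ 1 = ν ^ c := by
    rw [pow_eq_pow_iff_modEq, hν, ← ZMod.natCast_eq_natCast_iff]; exact h2
  rw [pow_one] at h3
  rw [← h3] at h
  exact h

/-! ### Affine symmetries of a set of residues -/

/-- Affine self-maps of a finite set of nonzero residues fix its barycentre. -/
theorem sum_eq_card_mul_add_mul_sum {p : ℕ} [Fact p.Prime] (S : Finset (ZMod p))
    {b c : ZMod p} (hc : c ≠ 0) (h : ∀ s ∈ S, b + c * s ∈ S) :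
    ∑ s ∈ S, s = (S.card : ZMod p) * b + c * ∑ s ∈ S, s := by
  have hinj : Function.Injective fun s : ZMod p => b + c * s := fun x y hxy =>
    mul_left_cancel₀ hc (add_left_cancel hxy)
  have himg : S.image (fun s => b + c * s) = S :=
    Finset.eq_of_subset_of_card_le (Finset.image_subset_iff.2 h)
      (Finset.card_image_of_injective S hinj).ge
  conv_lhs => rw [← himg]
  rw [Finset.sum_image fun x _ y _ hxy => hinj hxy, Finset.sum_add_distrib, Finset.sum_const,
    nsmul_eq_mul, Finset.mul_sum]

theorem card_ne_zero_of_zero_notMem {p : ℕ} [hp : Fact p.Prime] {S : Finset (ZMod p)}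
    (hS : S.Nonempty) (h0 : (0 : ZMod p) ∉ S) : (S.card : ZMod p) ≠ 0 := by
  intro h
  rw [ZMod.natCast_eq_zero_iff] at h
  have h1 := Nat.le_of_dvd hS.card_pos h
  have h2 : S.card < Fintype.card (ZMod p) := Finset.card_lt_univ_of_notMem h0
  rw [ZMod.card] at h2
  omega

/-- If `π` acts on every orbit of `ν` as a power of `ν`, and `ν` acts freely, then a group
normalizing `⟨ν⟩` and centralizing `π` modulo `⟨ν⟩` normalizes `⟨π⟩`, provided a transitive group
normalizes both `⟨π⟩` and `⟨ν⟩`. -/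
theorem exists_mul_eq_pow_mul_of_transitive {p : ℕ} (hp : p.Prime) {X : Type*} [Finite X]
    [Nonempty X] {π ν : Equiv.Perm X} (hν : orderOf ν = p)
    (hfree : ∀ (x : X) (i : ℕ), (ν ^ i) x = x → ν ^ i = 1) (hπ : ∀ x, π x ≠ x)
    (hcomm : Commute π ν) {G N : Set (Equiv.Perm X)}
    (htrans : ∀ x y : X, ∃ g ∈ G, g x = y)
    (hGπ : ∀ g ∈ G, ∃ u : ℕ, g * π = π ^ u * g) (hGν : ∀ g ∈ G, ∃ v : ℕ, g * ν = ν ^ v * g)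
    (hNν : ∀ n ∈ N, ∃ c : ℕ, n * ν = ν ^ c * n)
    (hNπ : ∀ n ∈ N, ∃ b : ℕ, π * n = ν ^ b * n * π)
    (hloc : ∀ x, ∃ a : ℕ, π x = (ν ^ a) x) :
    ∀ n ∈ N, ∃ k : ℕ, n * π = π ^ k * n := by
  have : Fact p.Prime := ⟨hp⟩
  have := Fintype.ofFinite X
  classical
  have hinj : ∀ (x : X) (i j : ℕ), (ν ^ i) x = (ν ^ j) x → (i : ZMod p) = j := by
    have key : ∀ (x : X) (i j : ℕ), i ≤ j → (ν ^ i) x = (ν ^ j) x → (i : ZMod p) = j := by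
      intro x i j hij h
      obtain ⟨d, rfl⟩ := Nat.exists_eq_add_of_le hij
      rw [pow_add, Equiv.Perm.mul_apply] at h
      have h1 := hfree x d ((ν ^ i).injective h).symm
      have h2 := orderOf_dvd_of_pow_eq_one h1
      rw [hν, ← ZMod.natCast_eq_zero_iff] at h2
      rw [Nat.cast_add, h2, add_zero]
    intro x i j h
    rcases le_total i j with hij | hij
    · exact key x i j hij h
    · exact (key x j i hij h.symm).symm
  have hpow : ∀ i j : ℕ, (i : ZMod p) = j → ν ^ i = ν ^ j := by
    intro i j h
    rw [pow_eq_pow_iff_modEq, hν, ← ZMod.natCast_eq_natCast_iff]; exact h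
  choose a ha using hloc
  let α : X → ZMod p := fun x => (a x : ZMod p)
  have hα0 : ∀ x, α x ≠ 0 := by
    intro x h
    have h1 : ((a x : ℕ) : ZMod p) = ((0 : ℕ) : ZMod p) := by rw [Nat.cast_zero]; exact h
    exact hπ x (by rw [ha, hpow _ _ h1]; rfl)
  -- conjugating `ν` by `g` raises powers
  have hconj : ∀ (g : Equiv.Perm X) (v : ℕ), g * ν = ν ^ v * g → ∀ (i : ℕ) (x : X),
      g ((ν ^ i) x) = (ν ^ (v * i)) (g x) := by
    intro g v h i x
    have hs : SemiconjBy g ν (ν ^ v) := h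
    have := (hs.pow_right i).eq
    rw [← pow_mul] at this
    exact congrArg (fun q : Equiv.Perm X => q x) this
  have hc0 : ∀ (g : Equiv.Perm X) (v : ℕ), g * ν = ν ^ v * g → (v : ZMod p) ≠ 0 := by
    intro g v h hv
    have h1 : ν ^ v = ν ^ 0 := hpow v 0 (by rw [Nat.cast_zero]; exact hv)
    rw [h1, pow_zero, one_mul, mul_eq_left] at h
    rw [h, orderOf_one] at hν
    exact hp.one_lt.ne hν
  have hπpow : ∀ (u : ℕ) (x : X), (π ^ u) x = (ν ^ (u * a x)) x := by
    intro u x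
    induction u with
    | zero => simp
    | succ u ih =>
      have hs := (hcomm.pow_right (u * a x)).eq
      calc (π ^ (u + 1)) x = π ((π ^ u) x) := by rw [pow_succ']; rfl
        _ = (π * ν ^ (u * a x)) x := by rw [ih]; rfl
        _ = (ν ^ (u * a x)) ((ν ^ a x) x) := by rw [hs, ← ha]; rfl
        _ = (ν ^ ((u + 1) * a x)) x := by rw [add_mul, one_mul, pow_add]; rfl
  -- The transformation laws of `α` come from comparing two expressions for `π (n x)`, and below for
  -- `g (π x)`, as powers of `ν` applied to one point.
  have hN : ∀ n ∈ N, ∀ b c : ℕ, π * n = ν ^ b * n * π → n * ν = ν ^ c * n → ∀ x,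
      α (n x) = b + c * α x := by
    intro n _ b c hb hc x
    have h1 : π (n x) = (ν ^ b) (n (π x)) := congrArg (fun q : Equiv.Perm X => q x) hb
    rw [ha, ha x, hconj n c hc] at h1
    have h2 : (ν ^ a (n x)) (n x) = (ν ^ (b + c * a x)) (n x) := by rw [h1, pow_add]; rfl
    have := hinj _ _ _ h2
    push_cast at this
    exact this
  have hG : ∀ g ∈ G, ∀ u v : ℕ, g * π = π ^ u * g → g * ν = ν ^ v * g → ∀ x,
      (u : ZMod p) * α (g x) = v * α x := by
    intro g _ u v hu hv x
    have h1 : g (π x) = (π ^ u) (g x) := congrArg (fun q : Equiv.Perm X => q x) hu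
    rw [ha x, hconj g v hv, hπpow] at h1
    have := hinj _ _ _ h1
    push_cast at this
    exact this.symm
  obtain ⟨x₀⟩ := ‹Nonempty X›
  let S : Finset (ZMod p) := Finset.univ.image α
  have hmemS : ∀ x, α x ∈ S := fun x => Finset.mem_image_of_mem α (Finset.mem_univ x)
  have hSne : S.Nonempty := ⟨_, hmemS x₀⟩
  have hS0 : (0 : ZMod p) ∉ S := by
    intro h
    obtain ⟨x, -, hx⟩ := Finset.mem_image.1 h
    exact hα0 x hx
  have hcard := card_ne_zero_of_zero_notMem hSne hS0
  intro n hn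
  obtain ⟨c, hc⟩ := hNν n hn
  obtain ⟨b, hb⟩ := hNπ n hn
  by_cases hconst : ∀ x, α x = α x₀
  · have hπν : π = ν ^ a x₀ := by
      ext x
      rw [ha x, hpow _ _ (hconst x)]
    refine ⟨c, ?_⟩
    have hs : SemiconjBy n ν (ν ^ c) := hc
    have := (hs.pow_right (a x₀)).eq
    rw [hπν, this, ← pow_mul, ← pow_mul, mul_comm c]
  · obtain ⟨x, hx⟩ := not_forall.1 hconst
    obtain ⟨g, hg, rfl⟩ := htrans x₀ x
    obtain ⟨u, hu⟩ := hGπ g hg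
    obtain ⟨v, hv⟩ := hGν g hg
    have hv0 := hc0 g v hv
    have hmul := hG g hg u v hu hv
    have hu0 : (u : ZMod p) ≠ 0 := by
      intro h
      have := hmul x₀
      rw [h, zero_mul] at this
      exact mul_ne_zero hv0 (hα0 x₀) this.symm
    have hσ := sum_eq_card_mul_add_mul_sum S (b := 0) (c := (u : ZMod p)⁻¹ * v)
      (mul_ne_zero (inv_ne_zero hu0) hv0) (by
        intro s hs
        obtain ⟨y, -, rfl⟩ := Finset.mem_image.1 hs
        rw [zero_add, mul_assoc, ← hmul y, inv_mul_cancel_left₀ hu0]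
        exact hmemS _)
    -- The scaling takes `α x₀` to the different value `α (g x₀)`.
    have hne : (u : ZMod p)⁻¹ * v ≠ 1 := by
      intro h
      apply hx
      have h1 := hmul x₀
      rw [← inv_mul_cancel_left₀ hu0 (α (g x₀)), h1, ← mul_assoc, h, one_mul]
    have hσ0 : ∑ s ∈ S, s = 0 := by
      rw [mul_zero, zero_add] at hσ
      by_contra h0
      exact hne (mul_right_cancel₀ h0 (by rw [one_mul, ← hσ]))
    have hσN := sum_eq_card_mul_add_mul_sum S (b := (b : ZMod p)) (c := (c : ZMod p))
      (hc0 n c hc) (by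
        intro s hs
        obtain ⟨y, -, rfl⟩ := Finset.mem_image.1 hs
        rw [← hN n hn b c hb hc]
        exact hmemS _)
    rw [hσ0, mul_zero, add_zero] at hσN
    have hb0 : (b : ZMod p) = ((0 : ℕ) : ZMod p) := by
      rw [Nat.cast_zero]
      exact (mul_eq_zero.1 hσN.symm).resolve_left hcard
    rw [hpow b 0 hb0, pow_zero, one_mul] at hb
    exact ⟨1, by rw [pow_one, hb]⟩

/-! ### Regular subgroups and the case `m < p` -/

theorem isRegular_leftRegular (Γ : Type*) [Group Γ] : IsRegular (leftRegular Γ) := by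
  constructor
  · intro x y
    exact ⟨MulAction.toPermHom Γ Γ (y * x⁻¹), ⟨_, rfl⟩, by simp⟩
  · rintro _ ⟨g, rfl⟩ x hx
    have : g * x = x := hx
    rw [mul_eq_right.1 this, map_one]

theorem IsRegular.natCard_eq {X : Type*} [Nonempty X] {N : Subgroup (Equiv.Perm X)}
    (hN : IsRegular N) : Nat.card N = Nat.card X := by
  obtain ⟨x⟩ := ‹Nonempty X›
  refine Nat.card_congr (Equiv.ofBijective (fun η : N => (η : Equiv.Perm X) x) ⟨?_, ?_⟩)
  · intro η ξ h
    have h1 : ((ξ : Equiv.Perm X)⁻¹ * η) x = x := by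
      have h' : (η : Equiv.Perm X) x = (ξ : Equiv.Perm X) x := h
      rw [Equiv.Perm.mul_apply, h']; exact Equiv.symm_apply_apply _ _
    have h2 := hN.2 _ (N.mul_mem (N.inv_mem ξ.2) η.2) x h1
    exact Subtype.ext (inv_mul_eq_one.1 h2).symm
  · intro y
    obtain ⟨η, hη, h⟩ := hN.1 x y
    exact ⟨⟨η, hη⟩, h⟩

/-- `Aut(Q)` embeds in the symmetric group on `Q`, whose order `m!` is prime to `p`. -/
theorem mem_FQ_of_lt {p m : ℕ} (hp : p.Prime) (hm : 0 < m) (hmp : m < p) : (p, m) ∈ FQ := by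
  refine ⟨hp, Nat.coprime_of_lt_prime hm.ne' hmp hp, fun Q _ hQ hdvd => ?_⟩
  have hQ : Nat.card Q = m := hQ
  have : Finite Q := Nat.finite_of_card_ne_zero (hQ ▸ hm.ne')
  have h1 : Nat.card (MulAut Q) ∣ Nat.card (Equiv.Perm Q) :=
    Subgroup.card_dvd_of_injective (MulAut.toPerm Q) fun φ ψ h =>
      MulEquiv.ext fun x => congrArg (fun σ : Equiv.Perm Q => σ x) h
  rw [Nat.card_perm, hQ] at h1
  exact absurd ((hp.dvd_factorial).1 (hdvd.trans h1)) (not_le.2 hmp)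

/-- The number of Sylow `p`-subgroups divides `m < p` and is `1` mod `p`. -/
theorem mem_FS_of_lt {p m : ℕ} (hp : p.Prime) (hm : 0 < m) (hmp : m < p) : (p, m) ∈ FS := by
  have hpm := Nat.coprime_of_lt_prime hm.ne' hmp hp
  refine ⟨hp, hpm, fun G _ hG => ?_⟩
  have : Fact p.Prime := ⟨hp⟩
  have hG : Nat.card G = m * p := hG
  change Nat.card (Sylow p G) = 1
  have : Finite G := Nat.finite_of_card_ne_zero (hG ▸ (Nat.mul_pos hm hp.pos).ne')
  have P : Sylow p G := default
  have h1 := P.card_dvd_index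
  have h2 := (P : Subgroup G).card_mul_index
  have h3 : Nat.card (P : Subgroup G) = p := card_sylow_eq_prime hp hpm hG P
  rw [h3, hG, mul_comm m] at h2
  rw [Nat.eq_of_mul_eq_mul_left hp.pos h2] at h1
  have h4 := Nat.le_of_dvd hm h1
  have h5 := card_sylow_modEq_one p G
  exact Nat.ModEq.eq_of_lt_of_lt h5 (h4.trans_lt hmp) hp.one_lt

theorem conj_mem_zpowers {B : Type*} [Group B] {π n : B} {k : ℕ} (h : n * π = π ^ k * n) {x : B}
    (hx : x ∈ zpowers π) : n * x * n⁻¹ ∈ zpowers π := by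
  obtain ⟨i, rfl⟩ := mem_zpowers_iff.1 hx
  rw [← conj_zpow, h, mul_inv_cancel_right]
  exact zpow_mem (pow_mem (mem_zpowers π) k) i

/-- A permutation `π` normalizing a regular group `N` and acting trivially on `N ⧸ K`, where `K`
has index prime to the order of `π`, maps each point into its `K`-orbit. -/
theorem IsRegular.exists_mem_apply_eq {X : Type*} {N : Subgroup (Equiv.Perm X)}
    (hN : IsRegular N) (K : Subgroup N) [K.Normal] {p : ℕ} (hpK : Nat.gcd p K.index = 1)
    {π : Equiv.Perm X} (hπ : π ^ p = 1) (φ : MulAut N)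
    (hφ : ∀ n : N, ((φ n : N) : Equiv.Perm X) * π = π * n) (hφK : ∀ n, φ n * n⁻¹ ∈ K) (x : X) :
    ∃ k ∈ K, π x = (k : Equiv.Perm X) x := by
  obtain ⟨n, hn, hnx⟩ := hN.1 x (π x)
  let n₀ : N := ⟨n, hn⟩
  have hφq : ∀ g : N, ((φ g : N) : N ⧸ K) = (g : N ⧸ K) := by
    intro g
    have h := (QuotientGroup.eq_one_iff _).2 (hφK g)
    rw [QuotientGroup.mk_mul, QuotientGroup.mk_inv] at h
    exact mul_inv_eq_one.1 h
  -- Modulo `K`, iterating `π` at `x` multiplies by `n₀` each time. At `k = p` this gives `n₀ ^ p ∈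
  -- K`, and the index of `K` is prime to `p`.
  have hk : ∀ k : ℕ, ∃ g : N, (π ^ k) x = (g : Equiv.Perm X) x ∧
      (g : N ⧸ K) = (n₀ : N ⧸ K) ^ k := by
    intro k
    induction k with
    | zero => exact ⟨1, rfl, by simp⟩
    | succ k ih =>
      obtain ⟨g, hg, hgq⟩ := ih
      refine ⟨φ g * n₀, ?_, ?_⟩
      · calc (π ^ (k + 1)) x = (π * g) x := by rw [pow_succ', Equiv.Perm.mul_apply, hg]; rfl
          _ = (φ g : Equiv.Perm X) (π x) := by rw [← hφ]; rfl
          _ = _ := by rw [← hnx]; rfl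
      · rw [QuotientGroup.mk_mul, hφq, hgq, pow_succ]
  obtain ⟨g, hg, hgq⟩ := hk p
  rw [hπ] at hg
  have hg1 : g = 1 := Subtype.ext (hN.2 g g.2 x hg.symm)
  rw [hg1, QuotientGroup.mk_one] at hgq
  have hord : (n₀ : N ⧸ K) ^ K.index = 1 := by
    rw [Subgroup.index]; exact pow_card_eq_one'
  have h1 : (n₀ : N ⧸ K) = 1 := by
    have := (pow_gcd_eq_one (a := (n₀ : N ⧸ K)) (m := p) (n := K.index)).2 ⟨hgq.symm, hord⟩
    rwa [hpK, pow_one] at this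
  exact ⟨n₀, (QuotientGroup.eq_one_iff _).1 h1, hnx.symm⟩

theorem le_normalizer_map_sylow_leftRegular {p m : ℕ} (hQ : (p, m) ∈ FQ) (hS : (p, m) ∈ FS)
    {Γ : Type*} [Group Γ] (hΓ : Nat.card Γ = m * p) (P : Sylow p (leftRegular Γ))
    {N : Subgroup (Equiv.Perm Γ)} (hreg : IsRegular N)
    (hnorm : leftRegular Γ ≤ normalizer (N : Set (Equiv.Perm Γ))) :
    N ≤ normalizer ((P : Subgroup (leftRegular Γ)).map (leftRegular Γ).subtype :
      Set (Equiv.Perm Γ)) := by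
  have hp : p.Prime := hQ.1
  have hpm : Nat.gcd p m = 1 := hQ.2.1
  have : Fact p.Prime := ⟨hp⟩
  have hm0 : m ≠ 0 := by
    rintro rfl
    rw [Nat.gcd_zero_right] at hpm
    exact hp.one_lt.ne' hpm
  have : Finite Γ := Nat.finite_of_card_ne_zero (hΓ ▸ mul_ne_zero hm0 hp.ne_zero)
  have hL := isRegular_leftRegular Γ
  have hLc : Nat.card (leftRegular Γ) = m * p := hL.natCard_eq.trans hΓ
  have hNc : Nat.card N = m * p := hreg.natCard_eq.trans hΓ
  have := subsingleton_sylow_of_mem_FS hS _ hLc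
  have := subsingleton_sylow_of_mem_FS hS _ hNc
  obtain ⟨π, hπL, hP, hπo, hπn⟩ :=
    exists_generator_of_subsingleton_sylow hp P (card_sylow_eq_prime hp hpm hLc P)
  have K : Sylow p N := default
  have hKc : Nat.card (K : Subgroup N) = p := card_sylow_eq_prime hp hpm hNc K
  obtain ⟨ν, hνN, hK, hνo, hνn⟩ := exists_generator_of_subsingleton_sylow hp K hKc
  have hKν : ∀ k : N, k ∈ (K : Subgroup N) → ∃ b : ℕ, (k : Equiv.Perm Γ) = ν ^ b := by
    intro k hk
    have h1 : (k : Equiv.Perm Γ) ∈ zpowers ν := hK ▸ mem_map_of_mem N.subtype hk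
    obtain ⟨b, hb⟩ := mem_powers_iff_mem_zpowers.2 h1
    exact ⟨b, hb.symm⟩
  have hchar : (K : Subgroup N).Characteristic := Sylow.characteristic_of_subsingleton K
  have hidx : (K : Subgroup N).index = m := by
    have := (K : Subgroup N).card_mul_index
    rw [hKc, hNc, mul_comm m] at this
    exact Nat.eq_of_mul_eq_mul_left hp.pos this
  have hπ1 : π ^ p = 1 := hπo ▸ pow_orderOf_eq_one π
  let φ : MulAut N := N.normalizerMonoidHom ⟨π, hnorm hπL⟩
  have hφp : φ ^ p = 1 := by
    rw [← map_pow, ← map_one N.normalizerMonoidHom]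
    exact congrArg _ (Subtype.ext hπ1)
  have hφ : ∀ n : N, ((φ n : N) : Equiv.Perm Γ) * π = π * n := fun n =>
    inv_mul_cancel_right (π * (n : Equiv.Perm Γ)) π
  have hφK : ∀ n, φ n * n⁻¹ ∈ (K : Subgroup N) :=
    apply_mul_inv_mem_of_not_dvd_card_mulAut hp (K : Subgroup N)
      (not_dvd_card_mulAut_of_mem_FQ hQ _ hidx) φ hφp
  have key := exists_mul_eq_pow_mul_of_transitive hp (π := π) (ν := ν) hνo
    (fun x i h => hreg.2 _ (N.pow_mem hνN i) x h)
    (fun x h => by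
      rw [hL.2 π hπL x h, orderOf_one] at hπo
      exact hp.one_lt.ne hπo)
    (by
      obtain ⟨c, hc⟩ := hνn π (hnorm hπL)
      exact commute_of_mul_eq_pow_mul hp hπ1 hνo hc)
    (G := leftRegular Γ) (N := N) hL.1
    (fun g hg => hπn g (le_normalizer hg)) (fun g hg => hνn g (hnorm hg))
    (fun n hn => hνn n (le_normalizer hn))
    (fun n hn => by
      obtain ⟨b, hb⟩ := hKν _ (hφK ⟨n, hn⟩)
      refine ⟨b, ?_⟩
      have h1 := hφ ⟨n, hn⟩
      rw [← hb, ← h1]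
      simp)
    (fun x => by
      obtain ⟨k, hk, hkx⟩ := hreg.exists_mem_apply_eq (K : Subgroup N) (p := p)
        (by rw [hidx]; exact hpm) hπ1 φ hφ hφK x
      obtain ⟨b, hb⟩ := hKν k hk
      exact ⟨b, by rw [hkx, hb]⟩)
  intro n hn
  rw [hP, mem_normalizer_iff]
  refine fun x => ⟨fun hx => ?_, fun hx => ?_⟩
  · obtain ⟨k, hk⟩ := key n hn
    exact conj_mem_zpowers hk hx
  -- The converse inclusion is the same statement for `n⁻¹`.
  · obtain ⟨k, hk⟩ := key n⁻¹ (N.inv_mem hn)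
    have := conj_mem_zpowers hk hx
    simpa [mul_assoc] using this

end HopfGaloisRegular

theorem mainTheorem3 :
    (∀ p m : ℕ, p.Prime → 0 < m → m < p →
      (p, m) ∈ HopfGaloisRegular.FQ ∩ HopfGaloisRegular.FS) ∧
    ∀ p m : ℕ, (p, m) ∈ HopfGaloisRegular.FQ ∩ HopfGaloisRegular.FS →
      ∀ (Γ : Type*) [Group Γ], Nat.card Γ = m * p →
        ∀ P : Sylow p (HopfGaloisRegular.leftRegular Γ),
          ∀ N ∈ HopfGaloisRegular.regularSubgroups Γ,
            N ≤ Subgroup.normalizer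
              ((P : Subgroup (HopfGaloisRegular.leftRegular Γ)).map
                (HopfGaloisRegular.leftRegular Γ).subtype) := by
  refine ⟨fun p m hp hm hmp => ⟨HopfGaloisRegular.mem_FQ_of_lt hp hm hmp,
    HopfGaloisRegular.mem_FS_of_lt hp hm hmp⟩, ?_⟩
  rintro p m ⟨hQ, hS⟩ Γ _ hΓ P N ⟨_, _, _, hreg, _, hnorm⟩
  exact HopfGaloisRegular.le_normalizer_map_sylow_leftRegular hQ hS hΓ P hreg hnorm
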